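/- \textbf{Setting.} Let $K\ge 1$ and let $\mathcal P$ be either a set of Bernoulli distributions with means in a set $\Theta\subseteq[0,1]$, or a set of Gaussian distributions with a fixed known variance $\sigma^2>0$ and means in a set $\Theta\subseteq\mathbb R$; let $\mathcal Q\supseteq\mathcal P$ be the set of all Bernoulli distributions (resp. of all Gaussian distributions with variance $\sigma^2$). Distributions are identified with their means, $D(\cdot\Vert\cdot)$ is the Kullback--Leibler divergence, $\Delta_K$ is the probability simplex in $\mathbb R^K$, and for $\bm P=(P_1,\dots,P_K)\in\mathcal P^K$ let $\mathcal I^*(\bm P)\subseteq[K]=\{1,\dots,K\}$ be the set of arms with the largest mean. Let $H:\mathcal P^K\to(0,\infty]$ be any complexity measure; we put $\infty\cdot x=\infty$ for all $x\in[0,\infty]$ in products $H(\bm P)\cdot x$, and $0\cdot\infty=0$ in the products $r\,D$ below. A fixed-budget algorithm chooses in each round an arm $I(t)\in[K]$ from the past observations, receives an independent reward distributed as $P_{I(t)}$, and after $T$ rounds recommends an arm $J(T)\in[K]$. For a sequence $\{\pi_T\}_{T\ge1}$ of algorithms, $\pi_T$ being run for $T$ rounds, the worst-case rate is \[ R(\{\pi_T\})=\inf_{\bm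 P\in\mathcal P^K}H(\bm P)\,\liminf_{T\to\infty}\frac1T\log\frac1{\mathbb P[J(T)\notin\mathcal I^*(\bm P)]}. \] For an integer $B\ge1$ let \[ R^{\mathrm{go}}_B=\sup_{\bm r^B,\,J}\ \inf_{\bm Q^B\in\mathcal Q^{KB}}\ \inf_{\bm P\in\mathcal P^K:\,J(\bm Q^B)\notin\mathcal I^*(\bm P)}\frac{H(\bm P)}{B}\sum_{i\in[K],\,b\in[B]}r_{b,i}(\bm Q_1,\dots,\bm Q_b)\,D(Q_{b,i}\Vert P_i), \] where $\bm Q^B=(\bm Q_1,\dots,\bm Q_B)$ and the supremum is over all functions $\bm r_b:\mathcal Q^{Kb}\to\Delta_K$ $(b=1,\dots,B)$ and $J:\mathcal Q^{KB}\to[K]$. For $\epsilon>0$ let $(\bm r^{*}_1,\dots,\bm r^{*}_B,J^*)$ be an $\epsilon$-optimal solution, i.e. one for which the value of the double infimum is at least $R^{\mathrm{go}}_B-\epsilon$. \textbf{DOT.} The delayed optimal tracking algorithm $\pi_{\mathrm{DOT},T}$ with this input splits the rounds into $B+K-1$ consecutive batches of $T_B=\lfloor T/(B+K-1)\rfloor$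 rounds each (left-over rounds are ignored). In batch $b\le K$ it draws only arm $b$; the empirical means of the arms over these $K$ batches form the stored mean $\bm Q'_1$. For $a=1,\dots,B-1$ it puts $\bm r=\bm r^*_a(\bm Q'_1,\dots,\bm Q'_a)$, draws in batch $K+a$ each arm $i$ for $n_i\ge r_i(T_B-K)$ times with $\sum_i n_i=T_B$ (the choice of the $n_i$ and the order of the draws are otherwise arbitrary), observes the empirical means $\bm Q_{K+a}$ of this batch (an undrawn arm gets the value $0$), and sets $Q'_{a+1,i}=Q'_{a,i}+r_i\,(Q_{K+a,i}-Q'_{a,i})$ for all $i$. It recommends $J(T)=J^*(\bm Q'_1,\dots,\bm Q'_B)$. \textbf{Corollary (worst-case rate of DOT).} For all $B\ge1$, $\epsilon>0$, every $\epsilon$-optimal solution, and every sequence $\{\pi_{\mathrm{DOT},T}\}$ of DOT algorithms with this input, \[ R(\{\pi_{\mathrm{DOT},T}\})\ \ge\ \frac{B}{B+K-1}\,\bigl(R^{\mathrm{go}}_B-\epsilon\bigr). \] -/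

import Mathlib

open MeasureTheory ProbabilityTheory Filter
open scoped ENNReal NNReal

noncomputable section

namespace BestArm

/-- The two families of reward distributions: Bernoulli distributions, and Gaussian distributions
with a known variance `v > 0`. A member of a family is identified with its mean. -/
inductive RewardModel where
  | bernoulli : RewardModel
  | gaussian (v : ℝ≥0) (hv : 0 < v) : RewardModel

namespace RewardModel

/-- The means of all the members of the family; this is the class `𝒬` of estimated distributions,
a distribution being identified with its mean. -/
def means : RewardModel → Set ℝ
  | bernoulli => Set.Icc 0 1
  | gaussian _ _ => Set.univ

/-- The values that a reward can take. -/
def support : RewardModel → Set ℝ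
  | bernoulli => {0, 1}
  | gaussian _ _ => Set.univ

/-- The member of the family with mean `μ`. It is used for `μ ∈ means` only (in the Bernoulli case
a real outside `[0, 1]` is moved to the nearest end point, so that this is a probability measure
for every real `μ`). -/
def law : RewardModel → ℝ → Measure ℝ
  | bernoulli, μ => bernoulliMeasure (1 : ℝ) 0 (Set.projIcc 0 1 zero_le_one μ)
  | gaussian v _, μ => gaussianReal μ v

instance (M : RewardModel) (μ : ℝ) : IsProbabilityMeasure (M.law μ) := by
  cases M <;> simp only [law] <;> infer_instance

/-- The Kullback-Leibler divergence `D(Q‖P)` between the members with means `q` and `p`. -/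
def kl (M : RewardModel) (q p : ℝ) : ℝ≥0∞ :=
  InformationTheory.klDiv (M.law q) (M.law p)

end RewardModel

/-- The set `ℐ*` of best arms of an instance with means `μ`. -/
def bestArms {K : ℕ} (μ : Fin K → ℝ) : Set (Fin K) :=
  {i | ∀ j, μ j ≤ μ i}

/-- The product `h · x` of a complexity `h ∈ (0, ∞]` and a rate `x ∈ [0, ∞]`, where
`∞ · x = ∞` for every `x`, also for `x = 0` (an instance of infinite complexity puts no
constraint on the rate `R` in a bound `exp (-R T / H(P) + o(T))`). -/
def complexityMul (h : ℝ≥0∞) (x : EReal) : EReal :=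
  if h = ⊤ then ⊤ else (h : EReal) * x

/-! ### Batch-oracle rules and the rate `R^go_B` -/

/-- A pair `(r^B(·), J(·))`: allocation functions `r_1, …, r_B` into the probability simplex, `r_b`
depending on the estimated means `Q_1, …, Q_b` of the first `b` batches, and a recommendation
function `J` of `Q_1, …, Q_B`. Batches are numbered from `0` here, so `alloc b` has the `b + 1`
arguments `Q_0, …, Q_b`. The functions are total on real vectors; only their values at vectors
with coordinates in the class of means of the model matter. -/
structure BatchRule (K B : ℕ) where
  alloc : (b : Fin B) → (Fin (b + 1) → Fin K → ℝ) → Fin K → ℝ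
  alloc_mem : ∀ b q, alloc b q ∈ stdSimplex ℝ (Fin K)
  recommend : (Fin B → Fin K → ℝ) → Fin K

/-- The objective of a batch-oracle rule:
`inf_{Q^B} inf_{P : J(Q^B) ∉ ℐ*(P)} (H(P) / B) ∑_{i, b} r_{b,i}(Q_1, …, Q_b) D(Q_{b,i}‖P_i)`. -/
def BatchRule.value {K B : ℕ} (ρ : BatchRule K B) (M : RewardModel) (Θ : Set ℝ)
    (H : (Fin K → Θ) → ℝ≥0∞) : EReal :=
  ⨅ (Q : Fin B → Fin K → ℝ) (_ : ∀ b i, Q b i ∈ M.means)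
    (P : Fin K → Θ) (_ : ρ.recommend Q ∉ bestArms (fun i => (P i : ℝ))),
    complexityMul (H P)
      (((∑ i : Fin K, ∑ b : Fin B,
        ENNReal.ofReal (ρ.alloc b (fun c => Q (c.castLE b.isLt)) i) * M.kl (Q b i) (P i)) / B :
          ℝ≥0∞) : EReal)

/-- The rate `R^go_B`: the supremum of the objective over all batch-oracle rules. -/
def goRate (M : RewardModel) (Θ : Set ℝ) {K : ℕ} (H : (Fin K → Θ) → ℝ≥0∞) (B : ℕ) : EReal :=
  ⨆ ρ : BatchRule K B, ρ.value M Θ H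

/-- `ρ` is an `ε`-optimal solution of the maximization that defines `R^go_B`. -/
def BatchRule.IsEpsOptimal {K B : ℕ} (ρ : BatchRule K B) (M : RewardModel) (Θ : Set ℝ)
    (H : (Fin K → Θ) → ℝ≥0∞) (ε : ℝ) : Prop :=
  goRate M Θ H B - (ε : EReal) ≤ ρ.value M Θ H

/-! ### Algorithms, the probability of error and the worst-case rate -/

/-- A fixed-budget algorithm: the next arm, and the final recommendation, as functions of the
history, the list of the pairs (arm, reward) of the past rounds, oldest first. -/
structure Algorithm (K : ℕ) where
  arm : List (Fin K × ℝ) → Fin K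
  recommend : List (Fin K × ℝ) → Fin K

namespace Algorithm

variable {K : ℕ} (π : Algorithm K) (Y : Fin K × ℕ → ℝ)

/-- The history after `t` rounds, when `Y (i, s)` is the reward of the draw number `s` of arm `i`
(draws are counted from `0`). -/
def history : ℕ → List (Fin K × ℝ)
  | 0 => []
  | t + 1 =>
    let h := history t
    h ++ [(π.arm h, Y (π.arm h, h.countP (fun x => x.1 = π.arm h)))]

/-- The arm `I` drawn in round `t` (rounds are counted from `0`). -/
def drawn (t : ℕ) : Fin K := π.arm (π.history Y t)

/-- The number of draws of arm `i` in the rounds `a ≤ t < b`. -/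
def pulls (a b : ℕ) (i : Fin K) : ℕ :=
  ((Finset.Ico a b).filter (fun t => π.drawn Y t = i)).card

/-- The reward `X` received in round `t`. -/
def reward (t : ℕ) : ℝ := Y (π.drawn Y t, π.pulls Y 0 t (π.drawn Y t))

/-- The empirical mean of arm `i` over the rounds `a ≤ t < b` (`0` if it is not drawn there). -/
def empMean (a b : ℕ) (i : Fin K) : ℝ :=
  (∑ t ∈ (Finset.Ico a b).filter (fun t => π.drawn Y t = i), π.reward Y t) / π.pulls Y a b i

/-- The probability of error `ℙ[J(T) ∉ ℐ*(P)]` after `T` rounds, under the law that makes all the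
rewards `Y (i, s)` independent, with `Y (i, s)` distributed according to `P_i`. -/
def errorProb (M : RewardModel) (P : Fin K → ℝ) (T : ℕ) : ℝ≥0∞ :=
  Measure.infinitePi (fun p : Fin K × ℕ => M.law (P p.1))
    {Y | π.recommend (π.history Y T) ∉ bestArms P}

end Algorithm

/-- The worst-case rate of a sequence of algorithms,
`R({π_T}) = inf_{P ∈ 𝒫^K} H(P) liminf_{T → ∞} (1 / T) log (1 / ℙ[J(T) ∉ ℐ*(P)])`. -/
def worstCaseRate (M : RewardModel) (Θ : Set ℝ) {K : ℕ} (H : (Fin K → Θ) → ℝ≥0∞)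
    (π : ℕ → Algorithm K) : EReal :=
  ⨅ P : Fin K → Θ, complexityMul (H P)
    (liminf (fun T : ℕ =>
      ENNReal.log (((π T).errorProb M (fun i => (P i : ℝ)) T)⁻¹) / ((T : ℝ) : EReal)) atTop)

/-! ### Delayed optimal tracking -/

/-- `π` is the delayed optimal tracking algorithm (DOT) with horizon `T`, number of batches `B` and
input `ρ = (r^{B,*}, J^*)`. There are `B + K - 1` batches of `N = ⌊T / (B + K - 1)⌋` rounds, the
batch `b = 0, 1, …` consisting of the rounds `b N ≤ t < (b + 1) N`; left-over rounds are ignored.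
`Q a` is the stored empirical mean, denoted `Q'_{a+1}` if one counts from one.
* Arm `i` is drawn in all rounds of batch `i`, for each of the first `K` batches, and
  the stored mean is initialized with the empirical means of these batches.
* In batch `K + a` arm `i` is drawn at least `r_i (N - K)` times, where
  `r = r^{B,*}_a(Q_0, …, Q_a)`, and the stored mean is then updated with weights `r`.
* Finally `J^*` of the stored means is recommended.
How the draws are rounded and ordered inside a batch is left open, as in the description of
the algorithm. -/
def IsDOT {K B : ℕ} (M : RewardModel) (ρ : BatchRule K B) (T : ℕ) (π : Algorithm K) : Prop :=
  let N : ℕ := T / (B + K - 1)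
  ∀ Y : Fin K × ℕ → ℝ, (∀ p, Y p ∈ M.support) →
    ∃ Q : ℕ → Fin K → ℝ,
      (∀ (i : Fin K) (t : ℕ), (i : ℕ) * N ≤ t → t < ((i : ℕ) + 1) * N → π.drawn Y t = i) ∧
      (∀ i, Q 0 i = π.empMean Y 0 (K * N) i) ∧
      (∀ (a : ℕ) (ha : a + 1 < B) (i : Fin K),
        let r : ℝ := ρ.alloc ⟨a, Nat.lt_of_succ_lt ha⟩ (fun c => Q c) i
        r * ((N : ℝ) - K) ≤ π.pulls Y ((K + a) * N) ((K + a + 1) * N) i ∧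
        Q (a + 1) i =
          Q a i + r * (π.empMean Y ((K + a) * N) ((K + a + 1) * N) i - Q a i)) ∧
      π.recommend (π.history Y T) = ρ.recommend (fun b => Q b)

end BestArm

end

/-!
On the event that DOT errs, the instance `P` is one of those over which the objective of `ρ` at the
stored means `Q'` is minimized, so that `H(P) / B * ∑ r D(Q'‖P)` is at least the value of `ρ`. The
sum is about stored means, which are not empirical means of a fresh sample. It is controlled by the
divergences of the empirical means `Q` of the batches: by convexity of `D(·‖p)`,
`D(Q'_{a+1}‖p) ≤ (1 - r_a) D(Q'_a‖p) + r_a D(Q_a‖p)`, and telescoping gives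
`∑ r_a D(Q'_a‖p) ≤ D(Q'_1‖p) + ∑ r_a D(Q_a‖p)`, the sums on the left and right running over all
batches and over all but the last one (`sum_mul_add_le_of_convex_step`). As arm `i` is drawn at least
`r_i (N - K)` times in a batch, the right-hand side times `N - K` is at most the sum of
`n D(empirical mean of n rewards‖p)` over all the blocks of rewards which the algorithm observes
(`IsDOT.exists_blocks`). The factor `B / (B + K - 1)` appears because `K` batches instead of one are
spent on the initial stored means, where each arm needs a full weight of `1`.

This sum has exponential tails with rate `1`, up to polynomial factors. The numbers of draws are
random, and the algorithm may choose them in any way, even nonmeasurably; but the rewards of a batch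
are consecutive entries of the reward sequences of the arms, so a union bound over the polynomially
many possible end points of the blocks reduces the claim to deterministic disjoint blocks. These
are independent (`lintegral_prod_of_dependsOn`), and `E exp (l n D) ≤ C (n + 1)` for each of them
if `l < 1` (`exists_expE_kl_le`): for Bernoulli rewards `exp (n D)` is the likelihood ratio of the
observations at the empirical mean, which takes `n + 1` values; for Gaussian rewards `2 n D` is the
square of a standard Gaussian variable. The resulting Chernoff bound
(`exists_errorProb_mul_expE_le`) holds for all `l < 1`, and the rate follows as `l → 1`
(`le_liminf_log_inv_div`).
-/

noncomputable section

namespace BestArm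

open InformationTheory

/-! ### The divergences of the two reward models -/

namespace RewardModel

lemma law_bernoulli {q : ℝ} (hq : q ∈ Set.Icc (0 : ℝ) 1) :
    bernoulli.law q
      = ENNReal.ofReal q • Measure.dirac 1 + ENNReal.ofReal (1 - q) • Measure.dirac 0 := by
  have h1 : Set.projIcc 0 1 zero_le_one q = ⟨q, hq⟩ := Set.projIcc_of_mem _ hq
  have h2 : ENNReal.ofReal q = (unitInterval.toNNReal ⟨q, hq⟩ : ℝ≥0∞) :=
    ENNReal.ofReal_eq_coe_nnreal hq.1
  have h3 : ENNReal.ofReal (1 - q)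
      = (unitInterval.toNNReal (unitInterval.symm ⟨q, hq⟩) : ℝ≥0∞) :=
    ENNReal.ofReal_eq_coe_nnreal (sub_nonneg.2 hq.2)
  simp only [law, h1, bernoulliMeasure_def, h2, h3]
  rfl

lemma lintegral_law_bernoulli {q : ℝ} (hq : q ∈ Set.Icc (0 : ℝ) 1) (f : ℝ → ℝ≥0∞) :
    ∫⁻ x, f x ∂(bernoulli.law q) = ENNReal.ofReal q * f 1 + ENNReal.ofReal (1 - q) * f 0 := by
  rw [law_bernoulli hq]
  simp [lintegral_add_measure, lintegral_smul_measure]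

/-- The likelihood ratio of the Bernoulli law with mean `q` to the one with mean `p`, at a reward
`x ∈ {0, 1}`. The division is that of `[0, ∞]`, so the ratio is `∞` at a reward which has positive
probability under `q` only. -/
def bernoulliRatio (q p x : ℝ) : ℝ≥0∞ :=
  if x = 1 then ENNReal.ofReal q / ENNReal.ofReal p
  else ENNReal.ofReal (1 - q) / ENNReal.ofReal (1 - p)

lemma measurable_bernoulliRatio (q p : ℝ) : Measurable (bernoulliRatio q p) :=
  Measurable.ite (measurableSet_singleton 1) measurable_const measurable_const

lemma law_bernoulli_eq_withDensity {q p : ℝ} (hq : q ∈ Set.Icc (0 : ℝ) 1)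
    (hp : p ∈ Set.Ioo (0 : ℝ) 1) :
    bernoulli.law q = (bernoulli.law p).withDensity (bernoulliRatio q p) := by
  have hp1 : ENNReal.ofReal p ≠ 0 := by simpa using hp.1
  have hp2 : ENNReal.ofReal (1 - p) ≠ 0 := by simpa using hp.2
  ext s hs
  rw [withDensity_apply _ hs, ← lintegral_indicator hs,
    lintegral_law_bernoulli (Set.Ioo_subset_Icc_self hp), law_bernoulli hq]
  by_cases h1 : (1 : ℝ) ∈ s <;> by_cases h0 : (0 : ℝ) ∈ s <;>
    simp [h1, h0, bernoulliRatio, ENNReal.mul_div_cancel hp1, ENNReal.mul_div_cancel hp2]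

lemma kl_bernoulli {q p : ℝ} (hq : q ∈ Set.Icc (0 : ℝ) 1) (hp : p ∈ Set.Ioo (0 : ℝ) 1) :
    bernoulli.kl q p
      = ENNReal.ofReal (p * klFun (q / p) + (1 - p) * klFun ((1 - q) / (1 - p))) := by
  have hp1 : 0 < 1 - p := by linarith [hp.2]
  have hac : bernoulli.law q ≪ bernoulli.law p := by
    rw [law_bernoulli_eq_withDensity hq hp]
    exact withDensity_absolutelyContinuous _ _
  have hrn : (bernoulli.law q).rnDeriv (bernoulli.law p)
      =ᵐ[bernoulli.law p] bernoulliRatio q p := by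
    rw [law_bernoulli_eq_withDensity hq hp]
    exact Measure.rnDeriv_withDensity _ (measurable_bernoulliRatio q p)
  rw [kl, klDiv_eq_lintegral_klFun_of_ac hac]
  rw [lintegral_congr_ae (g := fun x => ENNReal.ofReal (klFun (bernoulliRatio q p x).toReal))
    (by filter_upwards [hrn] with x hx; rw [hx]),
    lintegral_law_bernoulli (Set.Ioo_subset_Icc_self hp)]
  have e1 : (bernoulliRatio q p 1).toReal = q / p := by
    simp [bernoulliRatio, ENNReal.toReal_div, hq.1, hp.1.le]
  have e0 : (bernoulliRatio q p 0).toReal = (1 - q) / (1 - p) := by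
    simp [bernoulliRatio, ENNReal.toReal_div, hq.2, hp.2.le]
  rw [e1, e0, ← ENNReal.ofReal_mul hp.1.le, ← ENNReal.ofReal_mul hp1.le, ← ENNReal.ofReal_add]
  · exact mul_nonneg hp.1.le (klFun_nonneg (div_nonneg hq.1 hp.1.le))
  · exact mul_nonneg hp1.le (klFun_nonneg (div_nonneg (by linarith [hq.2]) hp1.le))

lemma kl_bernoulli_zero {q : ℝ} (hq : q ∈ Set.Ioc (0 : ℝ) 1) : bernoulli.kl q 0 = ⊤ := by
  apply klDiv_of_not_ac
  intro h
  have h0 : bernoulli.law 0 {1} = 0 := by rw [law_bernoulli (by simp)]; simp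
  have := h h0
  rw [law_bernoulli (Set.Ioc_subset_Icc_self hq)] at this
  simp at this
  linarith [hq.1]

lemma kl_bernoulli_one {q : ℝ} (hq : q ∈ Set.Ico (0 : ℝ) 1) : bernoulli.kl q 1 = ⊤ := by
  apply klDiv_of_not_ac
  intro h
  have h0 : bernoulli.law 1 {0} = 0 := by rw [law_bernoulli (by simp)]; simp
  have := h h0
  rw [law_bernoulli (Set.Ico_subset_Icc_self hq)] at this
  simp at this
  linarith [hq.2]

lemma kl_self (M : RewardModel) (q : ℝ) : M.kl q q = 0 := klDiv_self _

lemma kl_gaussian {v : ℝ≥0} (hv : 0 < v) (q p : ℝ) :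
    (gaussian v hv).kl q p = ENNReal.ofReal ((q - p) ^ 2 / (2 * v)) := by
  have hv' : (v : ℝ) ≠ 0 := by exact_mod_cast hv.ne'
  have hac : gaussianReal q v ≪ gaussianReal p v :=
    (gaussianReal_absolutelyContinuous q hv.ne').trans
      (gaussianReal_absolutelyContinuous' p hv.ne')
  have hllr : llr (gaussianReal q v) (gaussianReal p v) =ᵐ[gaussianReal q v]
      fun x => (q - p) / v * x + (p ^ 2 - q ^ 2) / (2 * v) := by
    have h1 : (gaussianReal q v).rnDeriv (gaussianReal p v) =ᵐ[volume]
        fun x => (gaussianPDF p v x)⁻¹ * gaussianPDF q v x := by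
      have h2 := Measure.rnDeriv_withDensity_right (gaussianReal q v) volume
        (measurable_gaussianPDF p v).aemeasurable
        (ae_of_all _ fun x => (gaussianPDF_pos p hv.ne' x).ne')
        (ae_of_all _ fun x => gaussianPDF_ne_top)
      rw [← gaussianReal_of_var_ne_zero p hv.ne'] at h2
      filter_upwards [h2, rnDeriv_gaussianReal q v] with x hx hx'
      rw [hx, hx']
    filter_upwards [gaussianReal_absolutelyContinuous q hv.ne' h1] with x hx
    have hx : (gaussianReal q v).rnDeriv (gaussianReal p v) x
      = (gaussianPDF p v x)⁻¹ * gaussianPDF q v x := hx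
    rw [llr, hx, ENNReal.toReal_mul, ENNReal.toReal_inv, toReal_gaussianPDF, toReal_gaussianPDF,
      Real.log_mul (inv_ne_zero (gaussianPDFReal_pos _ _ _ hv.ne').ne')
        (gaussianPDFReal_pos _ _ _ hv.ne').ne', Real.log_inv, gaussianPDFReal, gaussianPDFReal,
      Real.log_mul (by positivity) (by positivity), Real.log_mul (by positivity) (by positivity),
      Real.log_exp, Real.log_exp]
    field_simp
    ring
  have hid : Integrable (fun x : ℝ => x) (gaussianReal q v) :=
    (memLp_id_gaussianReal 1).integrable le_rfl
  have hint : Integrable (llr (gaussianReal q v) (gaussianReal p v)) (gaussianReal q v) :=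
    Integrable.congr ((hid.const_mul _).add (integrable_const _)) hllr.symm
  rw [kl, law, law, ← ENNReal.ofReal_toReal (klDiv_ne_top hac hint),
    toReal_klDiv_of_measure_eq hac (by simp), integral_congr_ae hllr,
    integral_add (hid.const_mul _) (integrable_const _), integral_const_mul,
    integral_id_gaussianReal]
  congr 1
  simp
  field_simp
  ring

/-- Convexity of the divergence in its first argument, along a segment of means. -/
lemma kl_convex (M : RewardModel) {q₀ q₁ p r : ℝ} (h₀ : q₀ ∈ M.means) (h₁ : q₁ ∈ M.means)
    (hp : p ∈ M.means) (hr0 : 0 ≤ r) (hr1 : r ≤ 1) :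
    M.kl (q₀ + r * (q₁ - q₀)) p
      ≤ ENNReal.ofReal (1 - r) * M.kl q₀ p + ENNReal.ofReal r * M.kl q₁ p := by
  have hr1' : 0 ≤ 1 - r := by linarith
  cases M with
  | gaussian v hv =>
    have hv' : (0 : ℝ) < v := by exact_mod_cast hv
    rw [kl_gaussian, kl_gaussian, kl_gaussian, ← ENNReal.ofReal_mul hr1', ← ENNReal.ofReal_mul hr0,
      ← ENNReal.ofReal_add (by positivity) (by positivity)]
    apply ENNReal.ofReal_le_ofReal
    rw [← mul_div_assoc, ← mul_div_assoc, ← add_div]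
    gcongr
    nlinarith [mul_nonneg (mul_nonneg hr0 hr1') (sq_nonneg (q₁ - q₀))]
  | bernoulli =>
    have hq : q₀ + r * (q₁ - q₀) ∈ Set.Icc (0 : ℝ) 1 := by
      have := (convex_Icc (0 : ℝ) 1) h₀ h₁ hr1' hr0 (by ring)
      convert this using 1
      simp only [smul_eq_mul]; ring
    -- For `p = 0` or `p = 1` a divergence is `0` or `∞`, and it is `∞` on the right-hand side if one
    -- of the means that carry weight differs from `p`.
    rcases hp.1.eq_or_lt with rfl | hp0
    · by_cases hq0 : q₀ = 0
      · by_cases hr : r = 0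
        · simp [hr]
        · by_cases hq1 : q₁ = 0
          · simp [hq0, hq1, kl_self]
          · rw [kl_bernoulli_zero ⟨lt_of_le_of_ne h₁.1 (Ne.symm hq1), h₁.2⟩, ENNReal.mul_top]
            · simp
            · simpa using lt_of_le_of_ne hr0 (Ne.symm hr)
      · by_cases hr : r = 1
        · simp [hr]
        · rw [kl_bernoulli_zero ⟨lt_of_le_of_ne h₀.1 (Ne.symm hq0), h₀.2⟩, ENNReal.mul_top]
          · simp
          · simpa using lt_of_le_of_ne hr1 hr
    rcases hp.2.eq_or_lt with rfl | hp1
    · by_cases hq0 : q₀ = 1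
      · by_cases hr : r = 0
        · simp [hr]
        · by_cases hq1 : q₁ = 1
          · simp [hq0, hq1, kl_self]
          · rw [kl_bernoulli_one ⟨h₁.1, lt_of_le_of_ne h₁.2 hq1⟩, ENNReal.mul_top]
            · simp
            · simpa using lt_of_le_of_ne hr0 (Ne.symm hr)
      · by_cases hr : r = 1
        · simp [hr]
        · rw [kl_bernoulli_one ⟨h₀.1, lt_of_le_of_ne h₀.2 hq0⟩, ENNReal.mul_top]
          · simp
          · simpa using lt_of_le_of_ne hr1 hr
    have hp1' : 0 < 1 - p := by linarith
    have nn : ∀ q : ℝ, q ∈ Set.Icc (0 : ℝ) 1 →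
        0 ≤ p * klFun (q / p) + (1 - p) * klFun ((1 - q) / (1 - p)) := fun q hq =>
      add_nonneg (mul_nonneg hp0.le (klFun_nonneg (div_nonneg hq.1 hp0.le)))
        (mul_nonneg hp1'.le (klFun_nonneg (div_nonneg (by linarith [hq.2]) hp1'.le)))
    rw [kl_bernoulli hq ⟨hp0, hp1⟩, kl_bernoulli h₀ ⟨hp0, hp1⟩, kl_bernoulli h₁ ⟨hp0, hp1⟩,
      ← ENNReal.ofReal_mul hr1', ← ENNReal.ofReal_mul hr0,
      ← ENNReal.ofReal_add (mul_nonneg hr1' (nn _ h₀)) (mul_nonneg hr0 (nn _ h₁))]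
    apply ENNReal.ofReal_le_ofReal
    have c1 := convexOn_klFun.2 (x := q₀ / p) (y := q₁ / p) (div_nonneg h₀.1 hp0.le)
      (div_nonneg h₁.1 hp0.le) hr1' hr0 (by ring)
    have c2 := convexOn_klFun.2 (x := (1 - q₀) / (1 - p)) (y := (1 - q₁) / (1 - p))
      (div_nonneg (by linarith [h₀.2]) hp1'.le) (div_nonneg (by linarith [h₁.2]) hp1'.le)
      hr1' hr0 (by ring)
    simp only [smul_eq_mul] at c1 c2
    have e1 : (1 - r) * (q₀ / p) + r * (q₁ / p) = (q₀ + r * (q₁ - q₀)) / p := by ring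
    have e2 : (1 - r) * ((1 - q₀) / (1 - p)) + r * ((1 - q₁) / (1 - p))
        = (1 - (q₀ + r * (q₁ - q₀))) / (1 - p) := by ring
    rw [e1] at c1
    rw [e2] at c2
    nlinarith [mul_le_mul_of_nonneg_left c1 hp0.le, mul_le_mul_of_nonneg_left c2 hp1'.le]

end RewardModel

/-! ### The exponential function on extended nonnegative reals -/

/-- The exponential function on `[0, ∞]`, with `exp ∞ = ∞`. -/
def expE (x : ℝ≥0∞) : ℝ≥0∞ := EReal.exp (x : EReal)

@[simp] lemma expE_zero : expE 0 = 1 := by simp [expE]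

lemma expE_add (x y : ℝ≥0∞) : expE (x + y) = expE x * expE y := by
  rw [expE, EReal.coe_ennreal_add, EReal.exp_add]; rfl

lemma expE_mono {x y : ℝ≥0∞} (h : x ≤ y) : expE x ≤ expE y :=
  EReal.exp_monotone (EReal.coe_ennreal_le_coe_ennreal_iff.2 h)

lemma expE_sum {J : Type*} (A : Finset J) (f : J → ℝ≥0∞) :
    expE (∑ j ∈ A, f j) = ∏ j ∈ A, expE (f j) := by
  classical
  induction A using Finset.induction_on with
  | empty => simp
  | insert j A hj ih => rw [Finset.sum_insert hj, Finset.prod_insert hj, expE_add, ih]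

lemma expE_ofReal {x : ℝ} (hx : 0 ≤ x) : expE (ENNReal.ofReal x) = ENNReal.ofReal (Real.exp x) := by
  rw [expE, EReal.coe_ennreal_ofReal, max_eq_left hx, EReal.exp_coe]

/-! ### Products over disjoint blocks of coordinates -/

section Independence

variable {ι : Type*} (P : ι → Measure ℝ) [∀ i, IsProbabilityMeasure (P i)]

/-- Functions of the coordinates in pairwise disjoint finite blocks are independent under a product
measure, in the form needed here: the expectation of their product factorizes. -/
lemma lintegral_prod_of_dependsOn {J : Type*} (A : Finset J) (S : J → Finset ι)
    (G : J → (ι → ℝ) → ℝ≥0∞) (hS : (A : Set J).PairwiseDisjoint S)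
    (hG : ∀ j, Measurable (G j)) (hdep : ∀ j, DependsOn (G j) (S j)) :
    ∫⁻ Y, ∏ j ∈ A, G j Y ∂(Measure.infinitePi P) = ∏ j ∈ A, ∫⁻ Y, G j Y ∂(Measure.infinitePi P) := by
  classical
  induction A using Finset.induction_on with
  | empty => simp
  | insert j A hj ih =>
    rw [Finset.prod_insert hj, ← ih (hS.subset (by simp))]
    simp_rw [Finset.prod_insert hj]
    have hindep : iIndepFun (fun (i : ι) (Y : ι → ℝ) => Y i) (Measure.infinitePi P) :=
      iIndepFun_infinitePi (X := fun _ x => x) (fun _ => measurable_id)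
    have hdisj : Disjoint (S j) (A.biUnion S) := by
      rw [Finset.disjoint_biUnion_right]
      intro k hk
      exact hS (by simp) (by simp [hk]) (by rintro rfl; exact hj hk)
    have h2 := hindep.indepFun_finset (S j) (A.biUnion S) hdisj (fun i => measurable_pi_apply i)
    -- A function of the coordinates in `U` factors through the restriction to `U`.
    let ext : (U : Finset ι) → (U → ℝ) → ι → ℝ := fun U z i => if h : i ∈ U then z ⟨i, h⟩ else 0
    have hext : ∀ U, Measurable (ext U) := by
      intro U
      refine measurable_pi_lambda _ fun i => ?_
      by_cases h : i ∈ U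
      · simp only [ext, h, dite_true]; exact measurable_pi_apply _
      · simp only [ext, h, dite_false]; exact measurable_const
    have hfac : ∀ (U : Finset ι) (g : (ι → ℝ) → ℝ≥0∞), DependsOn g U →
        ∀ Y, g Y = g (ext U (fun i : U => Y i)) := by
      intro U g hg Y
      apply hg
      intro i hi
      have hi : i ∈ U := hi
      simp [ext, hi]
    have hprod : Measurable fun Y => ∏ k ∈ A, G k Y := Finset.measurable_fun_prod _ fun k _ => hG k
    have hprod_dep : DependsOn (fun Y => ∏ k ∈ A, G k Y) (A.biUnion S : Finset ι) := by
      intro x y hxy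
      refine Finset.prod_congr rfl fun k hk => hdep k fun i hi => hxy i ?_
      have hi : i ∈ S k := hi
      simp only [Finset.coe_biUnion, Set.mem_iUnion, Finset.mem_coe]
      exact ⟨k, hk, hi⟩
    have h3 := h2.comp ((hG j).comp (hext (S j))) (hprod.comp (hext (A.biUnion S)))
    have e1 : ((G j ∘ ext (S j)) ∘ fun (Y : ι → ℝ) (i : S j) => Y i) = G j :=
      funext fun Y => (hfac _ _ (hdep j) Y).symm
    have e2 : (((fun Y => ∏ k ∈ A, G k Y) ∘ ext (A.biUnion S)) ∘
        fun (Y : ι → ℝ) (i : (A.biUnion S : Finset ι)) => Y i) = fun Y => ∏ k ∈ A, G k Y :=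
      funext fun Y => (hfac _ _ hprod_dep Y).symm
    rw [e1, e2] at h3
    exact lintegral_mul_eq_lintegral_mul_lintegral_of_indepFun (hG j) hprod h3

lemma lintegral_eval_infinitePi (i : ι) {f : ℝ → ℝ≥0∞} (hf : Measurable f) :
    ∫⁻ Y, f (Y i) ∂(Measure.infinitePi P) = ∫⁻ x, f x ∂(P i) := by
  rw [← Measure.infinitePi_map_eval P i, lintegral_map hf (measurable_pi_apply i)]

end Independence

/-! ### Exponential moments of the divergence of an empirical mean -/

section ExponentialMoment

variable {ι : Type*}

/-- For the empirical mean of `n` Bernoulli rewards, `exp (n D)` is dominated by a sum of `n + 1`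
likelihood ratios, one for each value of the empirical mean. -/
lemma expE_kl_le_bernoulli {m : ℝ} (hm : m ∈ Set.Icc (0 : ℝ) 1) (S : Finset ι) (Y : ι → ℝ)
    (hY : ∀ p, Y p ∈ RewardModel.bernoulli.support) :
    expE (S.card * RewardModel.bernoulli.kl ((∑ p ∈ S, Y p) / S.card) m)
      ≤ ∑ k ∈ Finset.range (S.card + 1),
          ∏ p ∈ S, RewardModel.bernoulliRatio ((k : ℝ) / S.card) m (Y p) := by
  classical
  have hY' : ∀ p, Y p = 0 ∨ Y p = 1 := fun p => by simpa [RewardModel.support] using hY p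
  set n := S.card with hn
  set k := (S.filter fun p => Y p = 1).card with hk
  have hkn : k ≤ n := Finset.card_filter_le _ _
  have hsum : ∑ p ∈ S, Y p = k := by
    rw [hk, Finset.card_filter]
    push_cast
    refine Finset.sum_congr rfl fun p _ => ?_
    rcases hY' p with h | h <;> simp [h]
  rcases Nat.eq_zero_or_pos n with h0 | hpos
  · have : S = ∅ := Finset.card_eq_zero.1 (hn ▸ h0)
    simp [h0, this]
  refine le_trans ?_ (Finset.single_le_sum (f := fun k : ℕ =>
    ∏ p ∈ S, RewardModel.bernoulliRatio ((k : ℝ) / n) m (Y p)) (fun _ _ => bot_le)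
    (Finset.mem_range.2 (Nat.lt_succ_of_le hkn)))
  rw [hsum]
  have hn' : (0 : ℝ) < n := by exact_mod_cast hpos
  have hkn' : (k : ℝ) ≤ n := by exact_mod_cast hkn
  set q : ℝ := (k : ℝ) / n with hq
  have hqm : q ∈ Set.Icc (0 : ℝ) 1 := ⟨by positivity, (div_le_one hn').2 hkn'⟩
  have hk0 : q = 0 ↔ k = 0 := by simp [hq, hpos.ne']
  have hk1 : q = 1 ↔ n - k = 0 := by
    rw [hq, div_eq_one_iff_eq hn'.ne']
    norm_cast
    omega
  have hprod : ∏ p ∈ S, RewardModel.bernoulliRatio q m (Y p)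
      = (ENNReal.ofReal q / ENNReal.ofReal m) ^ k
        * (ENNReal.ofReal (1 - q) / ENNReal.ofReal (1 - m)) ^ (n - k) := by
    simp only [RewardModel.bernoulliRatio]
    rw [Finset.prod_ite, Finset.prod_const, Finset.prod_const]
    congr 2
    have := Finset.card_filter_add_card_filter_not (s := S) (fun p => Y p = 1)
    omega
  rw [hprod]
  -- If `m` is `0` or `1`, the divergence is infinite unless `q = m`, and so is the likelihood ratio,
  -- thanks to `x / 0 = ∞` for `x ≠ 0`; an exponent `0` removes a factor `0`.
  rcases hm.1.eq_or_lt with rfl | hm0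
  · by_cases hq0 : q = 0
    · rw [hq0, RewardModel.kl_self, hk0.1 hq0]; simp
    · rw [ENNReal.ofReal_zero, ENNReal.div_zero (by simpa using lt_of_le_of_ne hqm.1 (Ne.symm hq0)),
        ENNReal.top_pow (fun h => hq0 (hk0.2 h)), ENNReal.top_mul]
      · exact le_top
      · by_cases hq1 : q = 1
        · simp [hk1.1 hq1]
        · apply pow_ne_zero
          simpa using lt_of_le_of_ne hqm.2 hq1
  rcases hm.2.eq_or_lt with rfl | hm1
  · by_cases hq1 : q = 1
    · rw [hq1, RewardModel.kl_self, hk1.1 hq1]; simp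
    · rw [sub_self, ENNReal.ofReal_zero,
        ENNReal.div_zero (by simpa using lt_of_le_of_ne hqm.2 hq1),
        ENNReal.top_pow (fun h => hq1 (hk1.2 h)), ENNReal.mul_top]
      · exact le_top
      · by_cases hq0 : q = 0
        · simp [hk0.1 hq0]
        · apply pow_ne_zero
          simpa using lt_of_le_of_ne hqm.1 (Ne.symm hq0)
  have hm1' : 0 < 1 - m := by linarith
  have hexp : ∀ (x : ℝ) (j : ℕ), 0 ≤ x → (x = 0 → j = 0) → Real.exp (j * Real.log x) = x ^ j := by
    intro x j hx hj
    rcases hx.eq_or_lt with h | h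
    · simp [hj h.symm]
    · rw [← Real.log_pow, Real.exp_log (pow_pos h _)]
  have hq1' : 0 ≤ 1 - q := by linarith [hqm.2]
  have hnn : 0 ≤ m * klFun (q / m) + (1 - m) * klFun ((1 - q) / (1 - m)) :=
    add_nonneg (mul_nonneg hm0.le (klFun_nonneg (div_nonneg hqm.1 hm0.le)))
      (mul_nonneg hm1'.le (klFun_nonneg (div_nonneg hq1' hm1'.le)))
  rw [RewardModel.kl_bernoulli hqm ⟨hm0, hm1⟩, ← ENNReal.ofReal_natCast,
    ← ENNReal.ofReal_mul hn'.le, expE_ofReal (mul_nonneg hn'.le hnn),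
    ← ENNReal.ofReal_div_of_pos hm0, ← ENNReal.ofReal_div_of_pos hm1',
    ← ENNReal.ofReal_pow (div_nonneg hqm.1 hm0.le), ← ENNReal.ofReal_pow (div_nonneg hq1' hm1'.le),
    ← ENNReal.ofReal_mul (pow_nonneg (div_nonneg hqm.1 hm0.le) _)]
  apply ENNReal.ofReal_le_ofReal
  rw [← hexp (q / m) k (div_nonneg hqm.1 hm0.le) (fun h => hk0.1 (by simpa [hm0.ne'] using h)),
    ← hexp ((1 - q) / (1 - m)) (n - k) (div_nonneg hq1' hm1'.le)
      (fun h => hk1.1 (by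
        have : 1 - q = 0 := by simpa [hm1'.ne'] using h
        linarith)), ← Real.exp_add]
  apply le_of_eq
  congr 1
  have e1 : (k : ℝ) = n * q := by rw [hq]; field_simp
  rw [Nat.cast_sub hkn, e1, klFun_apply, klFun_apply]
  field_simp
  ring

lemma lintegral_bernoulliRatio_le {q m : ℝ} (hq : q ∈ Set.Icc (0 : ℝ) 1)
    (hm : m ∈ Set.Icc (0 : ℝ) 1) :
    ∫⁻ x, RewardModel.bernoulliRatio q m x ∂(RewardModel.bernoulli.law m) ≤ 1 := by
  rw [RewardModel.lintegral_law_bernoulli hm]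
  calc _ ≤ ENNReal.ofReal q + ENNReal.ofReal (1 - q) := by
        simp only [RewardModel.bernoulliRatio, if_true, zero_ne_one, if_false]
        gcongr <;> exact ENNReal.mul_div_le
    _ = 1 := by
        rw [← ENNReal.ofReal_add hq.1 (by linarith [hq.2])]; simp

/-- A Gaussian variable with mean `m` and variance `w` has a finite moment
`E exp (l (x - m)² / (2 w)) = (1 - l) ^ (-1/2)` for `l < 1`: the integrand is the density of the
Gaussian law with variance `w / (1 - l)`, up to a factor. -/
lemma lintegral_exp_sq_gaussianReal (m : ℝ) {w : ℝ≥0} (hw : w ≠ 0) {l : ℝ≥0} (hl : l < 1) :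
    ∫⁻ x, ENNReal.ofReal (Real.exp (l * ((x - m) ^ 2 / (2 * w)))) ∂(gaussianReal m w)
      = ENNReal.ofReal (√(1 - l))⁻¹ := by
  have hl' : (0 : ℝ) < 1 - l := by
    have : (l : ℝ) < 1 := by exact_mod_cast hl
    linarith
  have hw' : (0 : ℝ) < w := by exact_mod_cast pos_iff_ne_zero.2 hw
  set u : ℝ≥0 := w / (1 - l) with hu
  have hu' : (u : ℝ) = w / (1 - l) := by
    rw [hu, NNReal.coe_div, NNReal.coe_sub hl.le]; rfl
  have hu0 : u ≠ 0 := by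
    intro h
    rw [h] at hu'
    have : (0 : ℝ) < w / (1 - l) := by positivity
    rw [← hu'] at this
    simp at this
  rw [gaussianReal_of_var_ne_zero m hw,
    lintegral_withDensity_eq_lintegral_mul _ (measurable_gaussianPDF m w) (by fun_prop)]
  have key : ∀ x : ℝ, (gaussianPDF m w * fun x =>
      ENNReal.ofReal (Real.exp (l * ((x - m) ^ 2 / (2 * w))))) x
      = ENNReal.ofReal (√(1 - l))⁻¹ * gaussianPDF m u x := by
    intro x
    rw [Pi.mul_apply, gaussianPDF, gaussianPDF,
      ← ENNReal.ofReal_mul (gaussianPDFReal_nonneg _ _ _), ← ENNReal.ofReal_mul (by positivity)]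
    congr 1
    rw [gaussianPDFReal, gaussianPDFReal, mul_assoc, ← Real.exp_add, ← mul_assoc, hu']
    congr 1
    · rw [← mul_inv, ← Real.sqrt_mul hl'.le]
      congr 2
      field_simp
    · congr 1
      field_simp
      ring
  simp_rw [key]
  rw [lintegral_const_mul _ (measurable_gaussianPDF m u), lintegral_gaussianPDF_eq_one m hu0, mul_one]

lemma map_sum_gaussianReal {v : ℝ≥0} (P : ι → Measure ℝ) [∀ i, IsProbabilityMeasure (P i)] (m : ℝ)
    (S : Finset ι) (hP : ∀ i ∈ S, P i = gaussianReal m v) :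
    (Measure.infinitePi P).map (fun Y => ∑ i ∈ S, Y i)
      = gaussianReal (S.card * m) (S.card * v) := by
  classical
  induction S using Finset.induction_on with
  | empty => simp [Measure.map_const]
  | insert j S hj ih =>
    have hindep : iIndepFun (fun (i : ι) (Y : ι → ℝ) => Y i) (Measure.infinitePi P) :=
      iIndepFun_infinitePi (X := fun _ x => x) (fun _ => measurable_id)
    have h1 := (hindep.indepFun_finsetSum_of_notMem (fun i => measurable_pi_apply i) hj).symm
    have h2 := gaussianReal_add_gaussianReal_of_indepFun h1
      ((Measure.infinitePi_map_eval P j).trans (hP j (by simp)))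
      (by
        rw [← ih (fun i hi => hP i (by simp [hi]))]
        congr 1
        ext Y
        simp)
    have e : (fun Y : ι → ℝ => ∑ i ∈ insert j S, Y i)
        = (fun Y => Y j) + ∑ i ∈ S, fun Y : ι → ℝ => Y i := by
      ext Y
      simp [Finset.sum_insert hj]
    rw [e, h2, Finset.card_insert_of_notMem hj]
    push_cast
    congr 1 <;> ring

/-- The exponential moment bound `E exp (l n D) ≤ C (n + 1)` for the divergence `D` of the empirical
mean of `n` rewards from the true mean, where `l < 1`. The bounding random variable `G` is used
because it is measurable and a function of the `n` rewards only. -/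
lemma exists_expE_kl_le (M : RewardModel) {l : ℝ≥0} (hl : l < 1) :
    ∃ C : ℝ≥0, ∀ (μ : ι → ℝ) (m : ℝ), m ∈ M.means → ∀ S : Finset ι, (∀ p ∈ S, μ p = m) →
      ∃ G : (ι → ℝ) → ℝ≥0∞, Measurable G ∧ DependsOn G S ∧
        ∫⁻ Y, G Y ∂(Measure.infinitePi fun p => M.law (μ p)) ≤ C * (S.card + 1) ∧
        ∀ Y : ι → ℝ, (∀ p, Y p ∈ M.support) →
          expE (l * (S.card * M.kl ((∑ p ∈ S, Y p) / S.card) m)) ≤ G Y := by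
  cases M with
  | bernoulli =>
    refine ⟨1, fun μ m hm S hS => ⟨fun Y => ∑ k ∈ Finset.range (S.card + 1),
      ∏ p ∈ S, RewardModel.bernoulliRatio ((k : ℝ) / S.card) m (Y p), ?_, ?_, ?_, ?_⟩⟩
    · exact Finset.measurable_fun_sum _ fun k _ => Finset.measurable_fun_prod _ fun p _ =>
        (RewardModel.measurable_bernoulliRatio _ _).comp (measurable_pi_apply p)
    · intro x y hxy
      refine Finset.sum_congr rfl fun k _ => Finset.prod_congr rfl fun p hp => ?_
      rw [hxy p hp]
    · have hmeas : ∀ k ∈ Finset.range (S.card + 1), Measurable fun Y : ι → ℝ =>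
          ∏ p ∈ S, RewardModel.bernoulliRatio ((k : ℝ) / S.card) m (Y p) := fun k _ =>
        Finset.measurable_fun_prod _ fun p _ =>
          (RewardModel.measurable_bernoulliRatio _ _).comp (measurable_pi_apply p)
      rw [lintegral_finsetSum _ hmeas]
      have : ∀ k ∈ Finset.range (S.card + 1),
          ∫⁻ Y, ∏ p ∈ S, RewardModel.bernoulliRatio ((k : ℝ) / S.card) m (Y p)
            ∂(Measure.infinitePi fun p => RewardModel.bernoulli.law (μ p)) ≤ 1 := by
        intro k hk
        have hk' : (k : ℝ) ≤ S.card := by exact_mod_cast Finset.mem_range_succ_iff.1 hk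
        rw [lintegral_prod_eq_prod_lintegral_of_indepFun S
          (fun p (Y : ι → ℝ) => RewardModel.bernoulliRatio ((k : ℝ) / S.card) m (Y p))
          (iIndepFun_infinitePi (fun _ => RewardModel.measurable_bernoulliRatio _ _))
          (fun p => (RewardModel.measurable_bernoulliRatio _ _).comp (measurable_pi_apply p))]
        refine Finset.prod_le_one' fun p hp => ?_
        rw [lintegral_eval_infinitePi _ p (RewardModel.measurable_bernoulliRatio _ _), hS p hp]
        exact lintegral_bernoulliRatio_le
          ⟨by positivity, div_le_one_of_le₀ hk' (Nat.cast_nonneg _)⟩ hm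
      refine (Finset.sum_le_card_nsmul _ _ 1 this).trans ?_
      simp
    · intro Y hY
      refine le_trans (expE_mono ?_) (expE_kl_le_bernoulli hm S Y hY)
      exact mul_le_of_le_one_left bot_le (by exact_mod_cast hl.le)
  | gaussian v hv =>
    refine ⟨max 1 (√(1 - l))⁻¹.toNNReal, fun μ m hm S hS => ?_⟩
    rcases Nat.eq_zero_or_pos S.card with h0 | hpos
    · refine ⟨fun _ => 1, measurable_const, fun _ _ _ => rfl, ?_, ?_⟩
      · simp [h0]
      · simp [h0]
    have hn : (0 : ℝ) < S.card := by exact_mod_cast hpos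
    have hv' : (0 : ℝ) < v := by exact_mod_cast hv
    have hw : (S.card : ℝ≥0) * v ≠ 0 := mul_ne_zero (by exact_mod_cast hpos.ne') hv.ne'
    set g : ℝ → ℝ≥0∞ := fun x => ENNReal.ofReal
      (Real.exp (l * ((x - S.card * m) ^ 2 / (2 * ((S.card * v : ℝ≥0) : ℝ))))) with hg
    have hgm : Measurable g := by fun_prop
    have hsm : Measurable fun Y : ι → ℝ => ∑ p ∈ S, Y p := by fun_prop
    refine ⟨fun Y => g (∑ p ∈ S, Y p), hgm.comp hsm, ?_, ?_, ?_⟩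
    · intro x y hxy
      simp only
      rw [Finset.sum_congr rfl fun p hp => hxy p hp]
    · rw [← lintegral_map hgm hsm, map_sum_gaussianReal _ m S
        (fun p hp => by rw [RewardModel.law, hS p hp]), hg,
        lintegral_exp_sq_gaussianReal _ hw hl]
      calc ENNReal.ofReal (√(1 - l))⁻¹ ≤ ((max 1 (√(1 - l))⁻¹.toNNReal : ℝ≥0) : ℝ≥0∞) * 1 := by
            rw [mul_one, ENNReal.ofReal]
            exact_mod_cast le_max_right _ _
        _ ≤ _ := by gcongr; simp
    · intro Y _
      rw [RewardModel.kl_gaussian, ← ENNReal.ofReal_natCast, ← ENNReal.ofReal_coe_nnreal (p := l),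
        ← ENNReal.ofReal_mul hn.le, ← ENNReal.ofReal_mul l.coe_nonneg, expE_ofReal (by positivity), hg]
      apply ENNReal.ofReal_le_ofReal
      apply le_of_eq
      congr 2
      push_cast
      field_simp

end ExponentialMoment

/-! ### Batches of rounds as blocks of draws -/

namespace Algorithm

variable {K : ℕ} (π : Algorithm K) (Y : Fin K × ℕ → ℝ)

lemma pulls_add {a b c : ℕ} (hab : a ≤ b) (hbc : b ≤ c) (i : Fin K) :
    π.pulls Y a c i = π.pulls Y a b i + π.pulls Y b c i := by
  rw [pulls, pulls, pulls, ← Finset.card_union_of_disjoint, ← Finset.filter_union,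
    Finset.Ico_union_Ico_eq_Ico hab hbc]
  exact Finset.disjoint_filter_filter (Finset.Ico_disjoint_Ico_consecutive a b c)

lemma pulls_mono {a b : ℕ} (hab : a ≤ b) (i : Fin K) : π.pulls Y 0 a i ≤ π.pulls Y 0 b i := by
  rw [π.pulls_add Y (Nat.zero_le a) hab]
  exact Nat.le_add_right _ _

lemma pulls_zero_le (b : ℕ) (i : Fin K) : π.pulls Y 0 b i ≤ b :=
  (Finset.card_filter_le _ _).trans (by simp)

lemma pulls_succ (t : ℕ) (i : Fin K) :
    π.pulls Y 0 (t + 1) i = π.pulls Y 0 t i + if π.drawn Y t = i then 1 else 0 := by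
  rw [π.pulls_add Y (Nat.zero_le t) (Nat.le_succ t), pulls.eq_def (a := t)]
  simp [Finset.filter_singleton, apply_ite Finset.card]

/-- The rewards of arm `i` in the rounds `a ≤ t < b` are those of its consecutive draws whose
numbers lie between the numbers of draws before `a` and before `b`. -/
lemma sum_reward_eq {a b : ℕ} (hab : a ≤ b) (i : Fin K) :
    ∑ t ∈ (Finset.Ico a b).filter (fun t => π.drawn Y t = i), π.reward Y t
      = ∑ s ∈ Finset.Ico (π.pulls Y 0 a i) (π.pulls Y 0 b i), Y (i, s) := by
  induction b, hab using Nat.le_induction with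
  | base => simp
  | succ b hab ih =>
    rw [← Finset.insert_Ico_right_eq_Ico_add_one hab, Finset.filter_insert, pulls_succ]
    by_cases h : π.drawn Y b = i
    · rw [if_pos h, if_pos h, Finset.sum_insert (by simp), ih,
        Finset.sum_Ico_succ_top (π.pulls_mono Y hab i), add_comm, reward, h]
    · rw [if_neg h, if_neg h, ih, add_zero]

end Algorithm

/-- The block of the draws of arm `i` with numbers `a ≤ s < b`. -/
def drawBlock {K : ℕ} (i : Fin K) (a b : ℕ) : Finset (Fin K × ℕ) := {i} ×ˢ Finset.Ico a b

lemma card_drawBlock {K : ℕ} (i : Fin K) (a b : ℕ) : (drawBlock i a b).card = b - a := by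
  simp [drawBlock]

/-- The number of draws in the block `S` times the divergence of their empirical mean from `p`. -/
def blockDiv {K : ℕ} (M : RewardModel) (Y : Fin K × ℕ → ℝ) (p : ℝ) (S : Finset (Fin K × ℕ)) :
    ℝ≥0∞ :=
  S.card * M.kl ((∑ x ∈ S, Y x) / S.card) p

namespace Algorithm

variable {K : ℕ} (π : Algorithm K) (Y : Fin K × ℕ → ℝ)

lemma pulls_mul_kl_empMean (M : RewardModel) (p : ℝ) {a b : ℕ} (hab : a ≤ b) (i : Fin K) :
    π.pulls Y a b i * M.kl (π.empMean Y a b i) p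
      = blockDiv M Y p (drawBlock i (π.pulls Y 0 a i) (π.pulls Y 0 b i)) := by
  have h : π.pulls Y 0 b i - π.pulls Y 0 a i = π.pulls Y a b i := by
    rw [π.pulls_add Y (Nat.zero_le a) hab]; simp
  rw [blockDiv, card_drawBlock, h, empMean, sum_reward_eq π Y hab, drawBlock, Finset.sum_product]
  simp

lemma empMean_mem {M : RewardModel} (hY : ∀ p, Y p ∈ M.support) (a b : ℕ) (i : Fin K) :
    π.empMean Y a b i ∈ M.means := by
  cases M with
  | gaussian v hv => trivial
  | bernoulli =>
    have hY' : ∀ t, 0 ≤ π.reward Y t ∧ π.reward Y t ≤ 1 := by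
      intro t
      have : π.reward Y t = 0 ∨ π.reward Y t = 1 := by
        simpa [RewardModel.support, Algorithm.reward] using hY _
      rcases this with h | h <;> simp [h]
    refine ⟨div_nonneg (Finset.sum_nonneg fun t _ => (hY' t).1) (Nat.cast_nonneg _),
      div_le_one_of_le₀ ?_ (Nat.cast_nonneg _)⟩
    rw [pulls]
    simpa using Finset.sum_le_card_nsmul _ _ 1 fun t _ => (hY' t).2

end Algorithm

lemma RewardModel.means_convex (M : RewardModel) : Convex ℝ M.means := by
  cases M with
  | gaussian v hv => exact convex_univ
  | bernoulli => exact convex_Icc 0 1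

/-! ### The error event of DOT -/

/-- The potential argument behind the delayed update: if `D (n + 1) ≤ (1 - r n) D n + r n E n`, then
the weighted potentials `r n * D n` are paid for by the observed divergences `r n * E n`. -/
lemma sum_mul_add_le_of_convex_step (r : ℕ → ℝ) (D E : ℕ → ℝ≥0∞) (n : ℕ)
    (hr0 : ∀ k < n, 0 ≤ r k) (hr1 : ∀ k < n, r k ≤ 1)
    (h : ∀ k < n, D (k + 1) ≤ ENNReal.ofReal (1 - r k) * D k + ENNReal.ofReal (r k) * E k) :
    ∑ k ∈ Finset.range n, ENNReal.ofReal (r k) * D k + D n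
      ≤ D 0 + ∑ k ∈ Finset.range n, ENNReal.ofReal (r k) * E k := by
  induction n with
  | zero => simp
  | succ n ih =>
    have ih := ih (fun k hk => hr0 k (by omega)) (fun k hk => hr1 k (by omega))
      (fun k hk => h k (by omega))
    have e : ENNReal.ofReal (r n) * D n + ENNReal.ofReal (1 - r n) * D n = D n := by
      rw [← add_mul, ← ENNReal.ofReal_add (hr0 n (by omega))
        (by linarith [hr1 n (Nat.lt_succ_self n)])]
      simp
    rw [Finset.sum_range_succ, Finset.sum_range_succ]
    calc _ ≤ ∑ k ∈ Finset.range n, ENNReal.ofReal (r k) * D k + ENNReal.ofReal (r n) * D n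
          + (ENNReal.ofReal (1 - r n) * D n + ENNReal.ofReal (r n) * E n) := by
          gcongr
          exact h n (Nat.lt_succ_self n)
      _ = (∑ k ∈ Finset.range n, ENNReal.ofReal (r k) * D k + D n)
          + ENNReal.ofReal (r n) * E n := by
          nth_rewrite 3 [← e]
          ring
      _ ≤ _ := by
          rw [← add_assoc]
          gcongr

/-- The rounds at which the blocks of observations end: the first `K` batches form one block, each
further batch is a block of its own. -/
def blockEnd (K N : ℕ) : ℕ → ℕ
  | 0 => 0
  | a + 1 => (K + a) * N

lemma blockEnd_mono (K N : ℕ) : Monotone (blockEnd K N) := by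
  refine monotone_nat_of_le_succ fun n => ?_
  cases n with
  | zero => exact Nat.zero_le _
  | succ n => exact Nat.mul_le_mul_right _ (by omega)

/-- If DOT errs, then the instance `P` is one of those over which the objective of `ρ` at the stored
means is minimized, and the divergence sum `W` in this objective, times the batch length, is at most
the log-likelihood exponent of the observations. -/
lemma IsDOT.exists_blocks {K B : ℕ} (hB : 1 ≤ B) {M : RewardModel} {Θ : Set ℝ}
    (hΘ : Θ ⊆ M.means) (H : (Fin K → Θ) → ℝ≥0∞) {ρ : BatchRule K B} {T : ℕ} {π : Algorithm K}
    (hπ : IsDOT M ρ T π) (P : Fin K → Θ) {Y : Fin K × ℕ → ℝ} (hY : ∀ p, Y p ∈ M.support)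
    (herr : π.recommend (π.history Y T) ∉ bestArms (fun i => (P i : ℝ))) :
    ∃ (m : Fin K → ℕ → ℕ) (W : ℝ≥0∞), (∀ i, Monotone (m i)) ∧ (∀ i, m i B ≤ T) ∧
      ρ.value M Θ H ≤ complexityMul (H P) ((W / B : ℝ≥0∞) : EReal) ∧
      ((T / (B + K - 1) - K : ℕ) : ℝ≥0∞) * W
        ≤ ∑ i, ∑ b ∈ Finset.range B, blockDiv M Y (P i) (drawBlock i (m i b) (m i (b + 1))) := by
  obtain ⟨B, rfl⟩ : ∃ B', B = B' + 1 := ⟨B - 1, by omega⟩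
  obtain ⟨Q, hbatch, hQ0, hstep, hrec⟩ := hπ Y hY
  set N := T / (B + 1 + K - 1) with hN
  -- The allocation of batch `a` at the stored means; its value for `a > B` is irrelevant.
  let r : ℕ → Fin K → ℝ := fun a i =>
    if ha : a < B + 1 then ρ.alloc ⟨a, ha⟩ (fun c => Q c) i else 0
  have hr0 : ∀ a i, a < B + 1 → 0 ≤ r a i := by
    intro a i ha
    simp only [r, ha, dite_true]
    exact (ρ.alloc_mem _ _).1 i
  have hr1 : ∀ a i, a < B + 1 → r a i ≤ 1 := by
    intro a i ha
    have hmem := ρ.alloc_mem ⟨a, ha⟩ (fun c => Q c)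
    simp only [r, ha, dite_true]
    rw [← hmem.2]
    exact Finset.single_le_sum (fun j _ => hmem.1 j) (Finset.mem_univ i)
  have hstep' : ∀ a < B, ∀ i, r a i * ((N : ℝ) - K)
        ≤ π.pulls Y ((K + a) * N) ((K + a + 1) * N) i ∧
      Q (a + 1) i = Q a i + r a i * (π.empMean Y ((K + a) * N) ((K + a + 1) * N) i - Q a i) := by
    intro a ha i
    have ha' : a < B + 1 := by omega
    simp only [r, ha', dite_true]
    exact hstep a (by omega) i
  have hQmem : ∀ a < B + 1, ∀ i, Q a i ∈ M.means := by
    intro a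
    induction a with
    | zero =>
      intro _ i
      rw [hQ0]
      exact π.empMean_mem Y hY _ _ _
    | succ a ih =>
      intro ha i
      rw [(hstep' a (by omega) i).2]
      have := M.means_convex (ih (by omega) i)
        (π.empMean_mem Y hY ((K + a) * N) ((K + a + 1) * N) i)
        (sub_nonneg.2 (hr1 a i (by omega))) (hr0 a i (by omega)) (by ring)
      convert this using 1
      simp only [smul_eq_mul]; ring
  let D : Fin K → ℕ → ℝ≥0∞ := fun i a => M.kl (Q a i) (P i)
  let E : Fin K → ℕ → ℝ≥0∞ := fun i a =>
    M.kl (π.empMean Y ((K + a) * N) ((K + a + 1) * N) i) (P i)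
  refine ⟨fun i b => π.pulls Y 0 (blockEnd K N b) i,
    ∑ i, ∑ b ∈ Finset.range (B + 1), ENNReal.ofReal (r b i) * D i b, ?_, ?_, ?_, ?_⟩
  · exact fun i a b hab => π.pulls_mono Y (blockEnd_mono K N hab) i
  · intro i
    refine (π.pulls_zero_le Y _ i).trans ?_
    have : K + B = B + 1 + K - 1 := by omega
    simp only [blockEnd]
    rw [this, mul_comm]
    exact Nat.div_mul_le_self T _
  · have hval : ρ.value M Θ H ≤ _ :=
      iInf_le_of_le (fun b : Fin (B + 1) => Q b) <|
        iInf_le_of_le (fun b i => hQmem b b.isLt i) <|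
          iInf_le_of_le P <| iInf_le_of_le (hrec ▸ herr) le_rfl
    refine hval.trans (le_of_eq ?_)
    congr 3
    refine Finset.sum_congr rfl fun i _ => ?_
    rw [Finset.sum_range]
    refine Finset.sum_congr rfl fun b _ => ?_
    have hb : (b : ℕ) < B + 1 := b.isLt
    simp only [r, hb, dite_true]
    rfl
  · rw [Finset.mul_sum]
    refine Finset.sum_le_sum fun i _ => ?_
    have hpot := sum_mul_add_le_of_convex_step (fun a => r a i) (D i) (E i) B
      (fun k hk => hr0 k i (by omega)) (fun k hk => hr1 k i (by omega)) (by
        intro k hk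
        simp only [D, E]
        rw [(hstep' k hk i).2]
        exact M.kl_convex (hQmem k (by omega) i) (π.empMean_mem Y hY _ _ i) (hΘ (P i).2)
          (hr0 k i (by omega)) (hr1 k i (by omega)))
    have hlast : ENNReal.ofReal (r B i) * D i B ≤ D i B :=
      mul_le_of_le_one_left bot_le (by simpa using hr1 B i (by omega))
    -- In the first `K` batches arm `i` is drawn in all the rounds of batch `i`.
    have hfirst : N ≤ π.pulls Y 0 (K * N) i := by
      have hsub : Finset.Ico ((i : ℕ) * N) ((i + 1) * N)
          ⊆ (Finset.Ico 0 (K * N)).filter (fun t => π.drawn Y t = i) := by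
        intro t ht
        rw [Finset.mem_Ico] at ht
        have : ((i : ℕ) + 1) * N ≤ K * N := Nat.mul_le_mul_right _ i.isLt
        simp only [Finset.mem_filter, Finset.mem_Ico]
        exact ⟨⟨Nat.zero_le _, by omega⟩, hbatch i t ht.1 ht.2⟩
      have := Finset.card_le_card hsub
      rw [Nat.card_Ico, ← Nat.sub_mul] at this
      simpa [Algorithm.pulls] using this
    have hbatches : ∀ a < B, ((N - K : ℕ) : ℝ≥0∞) * ENNReal.ofReal (r a i)
        ≤ π.pulls Y ((K + a) * N) ((K + a + 1) * N) i := by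
      intro a ha
      rcases le_total K N with h | h
      · rw [← ENNReal.ofReal_natCast, ← ENNReal.ofReal_natCast (π.pulls _ _ _ _),
          ← ENNReal.ofReal_mul (Nat.cast_nonneg _), Nat.cast_sub h, mul_comm]
        exact ENNReal.ofReal_le_ofReal (hstep' a ha i).1
      · simp [Nat.sub_eq_zero_of_le h]
    calc ((N - K : ℕ) : ℝ≥0∞) * ∑ b ∈ Finset.range (B + 1), ENNReal.ofReal (r b i) * D i b
        ≤ ((N - K : ℕ) : ℝ≥0∞)
            * (D i 0 + ∑ a ∈ Finset.range B, ENNReal.ofReal (r a i) * E i a) := by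
          gcongr
          rw [Finset.sum_range_succ]
          exact (add_le_add_right hlast _).trans hpot
      _ = ((N - K : ℕ) : ℝ≥0∞) * D i 0
            + ∑ a ∈ Finset.range B, ((N - K : ℕ) : ℝ≥0∞) * ENNReal.ofReal (r a i) * E i a := by
          rw [mul_add, Finset.mul_sum]
          simp_rw [mul_assoc]
      _ ≤ π.pulls Y 0 (K * N) i * D i 0 + ∑ a ∈ Finset.range B,
            π.pulls Y ((K + a) * N) ((K + a + 1) * N) i * E i a := by
          gcongr with a ha
          · omega
          · exact hbatches a (Finset.mem_range.1 ha)
      _ = _ := by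
          rw [Finset.sum_range_succ', add_comm]
          congr 1
          · refine Finset.sum_congr rfl fun a _ => ?_
            exact π.pulls_mul_kl_empMean Y M (P i) (Nat.mul_le_mul_right _ (by omega)) i
          · simp only [D, hQ0, blockEnd, add_zero]
            exact π.pulls_mul_kl_empMean Y M (P i) (Nat.zero_le _) i

/-! ### The probability of error of DOT -/

lemma RewardModel.ae_mem_support (M : RewardModel) {m : ℝ} (hm : m ∈ M.means) :
    ∀ᵐ x ∂(M.law m), x ∈ M.support := by
  cases M with
  | gaussian v hv => exact ae_of_all _ fun _ => trivial
  | bernoulli =>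
    rw [ae_iff, law_bernoulli hm]
    simp [RewardModel.support]

lemma ae_forall_mem_support {ι : Type*} [Countable ι] (M : RewardModel) (μ : ι → ℝ)
    (hμ : ∀ p, μ p ∈ M.means) :
    ∀ᵐ Y ∂(Measure.infinitePi fun p => M.law (μ p)), ∀ p, Y p ∈ M.support := by
  rw [ae_all_iff]
  intro p
  have h := M.ae_mem_support (hμ p)
  rw [← Measure.infinitePi_map_eval (fun p => M.law (μ p)) p] at h
  exact ae_of_ae_map (measurable_pi_apply p).aemeasurable h

/-- The Chernoff bound for DOT. Whatever the algorithm does, the blocks of draws that it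
observes are given by one of `(T + 1) ^ (K (B + 1))` tuples of end points, and for each fixed tuple
the exponential moment bounds multiply by independence. Here `s` is a lower bound for the
divergence sums that are compatible with the value of `ρ`. The error event need not be measurable. -/
lemma exists_errorProb_mul_expE_le {K B : ℕ} (hB : 1 ≤ B) {M : RewardModel} {Θ : Set ℝ}
    (hΘ : Θ ⊆ M.means) (H : (Fin K → Θ) → ℝ≥0∞) {ρ : BatchRule K B} (P : Fin K → Θ)
    {l : ℝ≥0} (hl : l < 1) {s : ℝ≥0∞}
    (hs : ∀ W : ℝ≥0∞, ρ.value M Θ H ≤ complexityMul (H P) ((W / B : ℝ≥0∞) : EReal) → s ≤ W) :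
    ∃ C : ℝ≥0, ∀ (T : ℕ) (π : Algorithm K), IsDOT M ρ T π →
      expE (l * ((T / (B + K - 1) - K : ℕ) * s)) * π.errorProb M (fun i => (P i : ℝ)) T
        ≤ ((C * (T + 1)) ^ (K * B) * (T + 1) ^ (K * (B + 1)) : ℝ≥0) := by
  classical
  obtain ⟨C, hC⟩ := exists_expE_kl_le (ι := Fin K × ℕ) M hl
  refine ⟨C, fun T π hπ => ?_⟩
  set P' : Measure (Fin K × ℕ → ℝ) := Measure.infinitePi fun p => M.law (P p.1) with hP'
  have hCi : ∀ (m : Fin K → Fin (B + 1) → Fin (T + 1)) (j : Fin K × Fin B),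
      ∃ G : (Fin K × ℕ → ℝ) → ℝ≥0∞, Measurable G ∧
        DependsOn G (drawBlock j.1 (m j.1 j.2.castSucc) (m j.1 j.2.succ)) ∧
        ∫⁻ Y, G Y ∂P' ≤ C * (T + 1) ∧ ∀ Y : Fin K × ℕ → ℝ, (∀ p, Y p ∈ M.support) →
          expE (l * blockDiv M Y (P j.1)
            (drawBlock j.1 (m j.1 j.2.castSucc) (m j.1 j.2.succ))) ≤ G Y := by
    intro m j
    obtain ⟨G, h1, h2, h3, h4⟩ := hC (fun p => (P p.1 : ℝ)) (P j.1) (hΘ (P j.1).2)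
      (drawBlock j.1 (m j.1 j.2.castSucc) (m j.1 j.2.succ)) (by
        intro p hp
        simp only [drawBlock, Finset.mem_product, Finset.mem_singleton] at hp
        rw [hp.1])
    refine ⟨G, h1, h2, h3.trans ?_, h4⟩
    rw [card_drawBlock]
    gcongr
    have := (m j.1 j.2.succ).isLt
    omega
  choose G hGm hGd hGi hGl using hCi
  set x : ℝ≥0∞ := (T / (B + K - 1) - K : ℕ) * s with hx
  let F : Finset (Fin K → Fin (B + 1) → Fin (T + 1)) :=
    Finset.univ.filter fun m => ∀ i, Monotone (m i)
  let A : (Fin K → Fin (B + 1) → Fin (T + 1)) → Set (Fin K × ℕ → ℝ) := fun m =>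
    {Y | expE (l * x) ≤ ∏ j, G m j Y}
  have hcover : π.errorProb M (fun i => (P i : ℝ)) T ≤ P' (⋃ m ∈ F, A m) := by
    rw [Algorithm.errorProb]
    refine measure_mono_ae ?_
    filter_upwards [ae_forall_mem_support M (fun p : Fin K × ℕ => (P p.1 : ℝ))
      (fun p => hΘ (P p.1).2)] with Y hY herr
    obtain ⟨m, W, hmono, hle, hval, hsum⟩ := hπ.exists_blocks hB hΘ H P hY herr
    have hlt : ∀ i (b : Fin (B + 1)), m i b < T + 1 := fun i b =>
      Nat.lt_succ_of_le ((hmono i (Nat.lt_succ_iff.1 b.isLt)).trans (hle i))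
    refine Set.mem_iUnion₂.2 ⟨fun i b => ⟨m i b, hlt i b⟩, ?_, ?_⟩
    · simp only [F, Finset.mem_filter, Finset.mem_univ, true_and]
      exact fun i a b hab => Fin.mk_le_mk.2 (hmono i hab)
    · change expE (l * x) ≤ _
      calc expE (l * x) ≤ expE (l * ∑ i, ∑ b ∈ Finset.range B,
            blockDiv M Y (P i) (drawBlock i (m i b) (m i (b + 1)))) := by
            apply expE_mono
            gcongr
            refine le_trans ?_ hsum
            rw [hx]
            gcongr
            exact hs W hval
        _ = ∏ j : Fin K × Fin B, expE (l * blockDiv M Y (P j.1)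
              (drawBlock j.1 (m j.1 j.2) (m j.1 (j.2 + 1)))) := by
            rw [← expE_sum, ← Finset.mul_sum, Fintype.sum_prod_type]
            simp_rw [Finset.sum_range]
        _ ≤ _ := by
            gcongr with j
            exact hGl (fun i b => ⟨m i b, hlt i b⟩) j Y hY
  have hA : ∀ m ∈ F, expE (l * x) * P' (A m) ≤ (C * (T + 1)) ^ (K * B) := by
    intro m hm
    have hmono : ∀ i, Monotone (m i) := by simpa [F] using hm
    have hmeas : Measurable fun Y => ∏ j, G m j Y :=
      Finset.measurable_fun_prod _ fun j _ => hGm m j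
    refine (mul_meas_ge_le_lintegral hmeas _).trans ?_
    rw [lintegral_prod_of_dependsOn (fun p : Fin K × ℕ => M.law (P p.1)) Finset.univ
      (fun j : Fin K × Fin B => drawBlock j.1 (m j.1 j.2.castSucc) (m j.1 j.2.succ)) (G m) ?_
      (hGm m) (hGd m)]
    · refine (Finset.prod_le_prod' fun j _ => hGi m j).trans ?_
      simp
    · rintro ⟨i, b⟩ - ⟨i', b'⟩ - hne
      simp only [Function.onFun, drawBlock]
      rw [Finset.disjoint_product]
      by_cases hii : i = i'
      · subst hii
        right
        have hbb : b ≠ b' := fun h => hne (by rw [h])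
        rcases lt_or_gt_of_ne hbb with h | h
        · have : m i b.succ ≤ m i b'.castSucc := hmono i (Fin.succ_le_castSucc_iff.2 h)
          exact Finset.disjoint_left.2 fun t ht ht' => by
            rw [Finset.mem_Ico] at ht ht'
            have : (m i b.succ : ℕ) ≤ m i b'.castSucc := this
            omega
        · have : m i b'.succ ≤ m i b.castSucc := hmono i (Fin.succ_le_castSucc_iff.2 h)
          exact Finset.disjoint_left.2 fun t ht ht' => by
            rw [Finset.mem_Ico] at ht ht'
            have : (m i b'.succ : ℕ) ≤ m i b.castSucc := this
            omega
      · left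
        simpa using hii
  calc expE (l * x) * π.errorProb M (fun i => (P i : ℝ)) T
      ≤ expE (l * x) * ∑ m ∈ F, P' (A m) := by
        gcongr
        exact hcover.trans (measure_biUnion_finset_le _ _)
    _ = ∑ m ∈ F, expE (l * x) * P' (A m) := Finset.mul_sum _ _ _
    _ ≤ F.card • ((C : ℝ≥0∞) * (T + 1)) ^ (K * B) := Finset.sum_le_card_nsmul _ _ _ hA
    _ ≤ ((T + 1) ^ (K * (B + 1)) : ℕ) • ((C : ℝ≥0∞) * (T + 1)) ^ (K * B) := by
        gcongr
        refine (Finset.card_filter_le _ _).trans ?_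
        simp [← pow_mul, mul_comm]
    _ = _ := by
        push_cast
        rw [nsmul_eq_mul, mul_comm]
        push_cast
        rfl

/-! ### From the exponential bound to the rate -/

/-- An exponential bound on the error probabilities with polynomial factors gives the exponential
rate. The factor `l < 1` is arbitrary, and batches have `⌊T / d⌋` rounds. -/
lemma le_liminf_log_inv_div {d K a b : ℕ} (hd : 1 ≤ d) (p : ℕ → ℝ≥0∞) (hp : ∀ T, p T ≤ 1)
    (s : ℝ≥0∞) (h : ∀ l : ℝ≥0, l < 1 → ∃ C : ℝ≥0, ∀ T : ℕ,
      expE (l * ((T / d - K : ℕ) * s)) * p T ≤ ((C * (T + 1)) ^ a * (T + 1) ^ b : ℝ≥0)) :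
    ((s / d : ℝ≥0∞) : EReal)
      ≤ liminf (fun T : ℕ => ENNReal.log (p T)⁻¹ / ((T : ℝ) : EReal)) atTop := by
  have hd' : (0 : ℝ) < d := by exact_mod_cast hd
  refine le_of_forall_lt fun z hz => ?_
  obtain ⟨y, hzy, hy⟩ := EReal.lt_iff_exists_real_btwn.1 hz
  refine hzy.trans_le (le_liminf_of_le (by isBoundedDefault) ?_)
  rcases lt_or_ge y 0 with hy0 | hy0
  · filter_upwards with T
    have h0 : 0 ≤ ENNReal.log (p T)⁻¹ := by
      rw [ENNReal.zero_le_log_iff]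
      exact ENNReal.one_le_inv.2 (hp T)
    exact (EReal.coe_nonpos.2 hy0.le).trans
      (EReal.div_nonneg h0 (EReal.coe_nonneg.2 (Nat.cast_nonneg T)))
  -- Choose `y d < l y' < y' < s` with `l < 1`.
  have hys : ENNReal.ofReal (y * d) < s := by
    have h1 : ((ENNReal.ofReal y : ℝ≥0∞) : EReal) < ((s / d : ℝ≥0∞) : EReal) := by
      rwa [EReal.coe_ennreal_ofReal, max_eq_left hy0]
    rw [EReal.coe_ennreal_lt_coe_ennreal_iff] at h1
    rw [ENNReal.ofReal_mul hy0, ENNReal.ofReal_natCast]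
    refine (ENNReal.lt_div_iff_mul_lt (Or.inl ?_) (Or.inl (ENNReal.natCast_ne_top d))).1 h1
    exact_mod_cast (by omega : d ≠ 0)
  obtain ⟨y', hy1, hy2⟩ := ENNReal.lt_iff_exists_nnreal_btwn.1 hys
  have hyy : y * d < y' := by
    rw [← ENNReal.ofReal_coe_nnreal] at hy1
    exact (ENNReal.ofReal_lt_ofReal_iff_of_nonneg (by positivity)).1 hy1
  have hy'0 : (0 : ℝ) < y' := lt_of_le_of_lt (by positivity) hyy
  obtain ⟨l, hl1, hl2⟩ : ∃ l : ℝ≥0, l < 1 ∧ y * d < l * y' := by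
    obtain ⟨t, ht1, ht2⟩ := exists_between ((div_lt_one hy'0).2 hyy)
    have ht0 : 0 ≤ t := le_trans (by positivity) ht1.le
    exact ⟨⟨t, ht0⟩, by exact_mod_cast ht2, (div_lt_iff₀ hy'0).1 ht1⟩
  obtain ⟨C, hC⟩ := h l hl1
  set δ : ℝ := l * y' / d - y with hδ
  have hδ0 : 0 < δ := by
    rw [hδ, sub_pos, lt_div_iff₀ hd']
    exact hl2
  set c : ℝ := l * y' * (K + 1) with hc
  -- The polynomial factor is absorbed by `exp (δ T)`.
  have hpoly : ∀ᶠ T : ℕ in atTop,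
      ((C : ℝ) * (T + 1)) ^ a * ((T : ℝ) + 1) ^ b ≤ Real.exp (δ * T - c) := by
    have h1 := (isLittleO_pow_exp_pos_mul_atTop (a + b) hδ0).def
      (c := Real.exp (-c - δ) / ((C : ℝ) ^ a + 1)) (by positivity)
    have h2 : Tendsto (fun T : ℕ => (T : ℝ) + 1) atTop atTop :=
      tendsto_atTop_add_const_right _ _ tendsto_natCast_atTop_atTop
    filter_upwards [h2.eventually h1] with T hT
    have hT1 : (0 : ℝ) < (T : ℝ) + 1 := by positivity
    rw [Real.norm_of_nonneg (by positivity), Real.norm_of_nonneg (by positivity), div_mul_eq_mul_div,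
      ← Real.exp_add, le_div_iff₀ (by positivity)] at hT
    calc ((C : ℝ) * (T + 1)) ^ a * ((T : ℝ) + 1) ^ b
        = ((T : ℝ) + 1) ^ (a + b) * (C : ℝ) ^ a := by rw [mul_pow, pow_add]; ring
      _ ≤ ((T : ℝ) + 1) ^ (a + b) * ((C : ℝ) ^ a + 1) := by gcongr; linarith
      _ ≤ _ := hT
      _ = Real.exp (δ * T - c) := by congr 1; ring
  filter_upwards [hpoly, eventually_gt_atTop 0] with T hT hT0
  have hT0' : (0 : ℝ) < T := by exact_mod_cast hT0
  have hN : (T : ℝ) / d - (K + 1) ≤ ((T / d - K : ℕ) : ℝ) := by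
    have h1 : (T : ℝ) / d < ((T / d : ℕ) : ℝ) + 1 := by
      rw [div_lt_iff₀ hd']
      exact_mod_cast Nat.lt_mul_of_div_lt (Nat.lt_succ_self _) (by omega)
    have h2 : ((T / d : ℕ) : ℝ) ≤ ((T / d - K : ℕ) : ℝ) + K := by
      exact_mod_cast (by omega : T / d ≤ T / d - K + K)
    linarith
  have hprob : p T ≤ ENNReal.ofReal (Real.exp (-(y * T))) := by
    have h1 : ENNReal.ofReal (Real.exp (l * y' * T / d - c)) * p T
        ≤ ENNReal.ofReal (Real.exp (δ * T - c)) := by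
      calc _ ≤ expE (l * ((T / d - K : ℕ) * s)) * p T := by
            gcongr
            calc ENNReal.ofReal (Real.exp (l * y' * T / d - c))
                ≤ ENNReal.ofReal (Real.exp (l * ((T / d - K : ℕ) * y'))) := by
                  apply ENNReal.ofReal_le_ofReal
                  apply Real.exp_le_exp.2
                  have := mul_le_mul_of_nonneg_left hN (mul_nonneg l.coe_nonneg hy'0.le)
                  rw [hc]
                  calc _ = (l : ℝ) * y' * ((T : ℝ) / d - (K + 1)) := by ring
                    _ ≤ _ := this
                    _ = _ := by ring
              _ = expE (l * ((T / d - K : ℕ) * y')) := by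
                  rw [← expE_ofReal (by positivity), ENNReal.ofReal_mul l.coe_nonneg,
                    ENNReal.ofReal_mul (Nat.cast_nonneg _), ENNReal.ofReal_natCast,
                    ENNReal.ofReal_coe_nnreal, ENNReal.ofReal_coe_nnreal]
              _ ≤ _ := expE_mono (by gcongr)
        _ ≤ _ := hC T
        _ ≤ _ := by
            rw [← ENNReal.ofReal_coe_nnreal]
            apply ENNReal.ofReal_le_ofReal
            push_cast
            exact hT
    have h2 : ENNReal.ofReal (Real.exp (δ * T - c))
        = ENNReal.ofReal (Real.exp (l * y' * T / d - c)) * ENNReal.ofReal (Real.exp (-(y * T))) := by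
      rw [← ENNReal.ofReal_mul (Real.exp_pos _).le, ← Real.exp_add, hδ]
      congr 2
      ring
    rw [h2] at h1
    exact (ENNReal.mul_le_mul_iff_right (by simpa using Real.exp_pos _) ENNReal.ofReal_ne_top).1 h1
  rw [EReal.le_div_iff_mul_le (by exact_mod_cast hT0') (EReal.coe_ne_top _)]
  calc (y : EReal) * ((T : ℝ) : EReal) = ENNReal.log (ENNReal.ofReal (Real.exp (y * T))) := by
        rw [← EReal.exp_coe, EReal.log_exp, EReal.coe_mul]
    _ ≤ _ := by
        apply ENNReal.log_monotone
        rw [ENNReal.le_inv_iff_le_inv, ← ENNReal.ofReal_inv_of_pos (Real.exp_pos _), ← Real.exp_neg]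
        exact hprob

lemma complexityMul_nonneg (h : ℝ≥0∞) (x : ℝ≥0∞) : 0 ≤ complexityMul h (x : EReal) := by
  rw [complexityMul]
  split_ifs
  · exact le_top
  · rw [← EReal.coe_ennreal_mul]
    exact EReal.coe_ennreal_nonneg _

lemma BatchRule.value_nonneg {K B : ℕ} (ρ : BatchRule K B) (M : RewardModel) (Θ : Set ℝ)
    (H : (Fin K → Θ) → ℝ≥0∞) : 0 ≤ ρ.value M Θ H :=
  le_iInf fun _ => le_iInf fun _ => le_iInf fun _ => le_iInf fun _ => complexityMul_nonneg _ _

end BestArm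

end

theorem mainTheorem5 (M : BestArm.RewardModel) (Θ : Set ℝ) (hΘ : Θ ⊆ M.means)
    (K B : ℕ) (hK : 1 ≤ K) (hB : 1 ≤ B)
    (H : (Fin K → Θ) → ENNReal) (hH : ∀ P, 0 < H P)
    (ε : ℝ) (hε : 0 < ε)
    (ρ : BestArm.BatchRule K B) (hρ : ρ.IsEpsOptimal M Θ H ε)
    (π : ℕ → BestArm.Algorithm K) (hπ : ∀ T, BestArm.IsDOT M ρ T (π T)) :
    (((B : ℝ) / ((B : ℝ) + (K : ℝ) - 1) : ℝ) : EReal) *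
        (BestArm.goRate M Θ H B - (ε : EReal)) ≤
      BestArm.worstCaseRate M Θ H π := by
  have hcast : (B : ℝ) + (K : ℝ) - 1 = ((B + K - 1 : ℕ) : ℝ) := by
    rw [Nat.cast_sub (by omega)]; push_cast; ring
  have hd : 1 ≤ B + K - 1 := by omega
  rw [hcast]
  set d := B + K - 1 with hdef
  have hd0 : (d : ℝ≥0∞) ≠ 0 := by exact_mod_cast (by omega : d ≠ 0)
  have hB0 : (B : ℝ≥0∞) ≠ 0 := by exact_mod_cast (by omega : B ≠ 0)
  set V : ℝ≥0∞ := (ρ.value M Θ H).toENNReal with hVdef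
  have hV : (V : EReal) = ρ.value M Θ H := EReal.coe_toENNReal (ρ.value_nonneg M Θ H)
  have hc : (((B : ℝ) / (d : ℝ) : ℝ) : EReal) = ((B / d : ℝ≥0∞) : EReal) := by
    rw [← ENNReal.ofReal_natCast, ← ENNReal.ofReal_natCast (n := d),
      ← ENNReal.ofReal_div_of_pos (by exact_mod_cast hd), EReal.coe_ennreal_ofReal,
      max_eq_left (by positivity)]
  refine (mul_le_mul_of_nonneg_left hρ (EReal.coe_nonneg.2 (by positivity))).trans ?_
  rw [hc, ← hV, ← EReal.coe_ennreal_mul]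
  refine le_iInf fun P => ?_
  by_cases hHP : H P = ⊤
  · simp [BestArm.complexityMul, hHP]
  have hHP0 : H P ≠ 0 := (hH P).ne'
  -- On the error event the divergence sum of the stored means is at least `s`.
  set s : ℝ≥0∞ := V * B / H P with hs
  have hsW : ∀ W : ℝ≥0∞,
      ρ.value M Θ H ≤ BestArm.complexityMul (H P) ((W / B : ℝ≥0∞) : EReal) → s ≤ W := by
    intro W hW
    rw [BestArm.complexityMul, if_neg hHP, ← hV, ← EReal.coe_ennreal_mul,
      EReal.coe_ennreal_le_coe_ennreal_iff, ← mul_div_assoc,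
      ENNReal.le_div_iff_mul_le (Or.inl hB0) (Or.inl (ENNReal.natCast_ne_top B))] at hW
    rw [hs, ENNReal.div_le_iff hHP0 hHP, mul_comm W]
    exact hW
  have hlim := BestArm.le_liminf_log_inv_div (K := K) (a := K * B) (b := K * (B + 1)) hd
    (fun T => (π T).errorProb M (fun i => (P i : ℝ)) T) (fun T => prob_le_one) s
    (fun l hl => by
      obtain ⟨C, hC⟩ := BestArm.exists_errorProb_mul_expE_le hB hΘ H P hl hsW
      exact ⟨C, fun T => hC T (π T) (hπ T)⟩)
  rw [BestArm.complexityMul, if_neg hHP]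
  refine le_trans (le_of_eq ?_)
    (mul_le_mul_of_nonneg_left hlim (EReal.coe_ennreal_nonneg _))
  rw [← EReal.coe_ennreal_mul]
  congr 1
  rw [hs, ← mul_div_assoc, ENNReal.mul_div_cancel hHP0 hHP, mul_comm, mul_div_assoc]
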